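/- **Conventions.** A *sampling problem* is a family $S=\{\mathcal D_x\}_{x\in\{0,1\}^*}$ of probability distributions on $\{0,1\}^*$; it is *polynomially bounded* if for some polynomial $p$ every $\mathcal D_x$ is supported on strings of length at most $p(|x|)$. Write $\|\cdot\|$ for total variation distance. $\mathsf{SampBPP/rpoly}$ is the class of polynomially bounded sampling problems for which there are a polynomial-time randomized algorithm $A$, a polynomial $p(n,m)$ and distributions $\mathcal D_{n,m}$ on $\{0,1\}^{p(n,m)}$ ($n\ge 0$, $m\ge 1$) such that for all $x\in\{0,1\}^*$ and all $m\ge 1$, with $n=|x|$, the output distribution of $A(x,0^m,y)$ averaged over $y\sim\mathcal D_{n,m}$ satisfies $$\|\mathcal D_A(x,0^m,\mathcal D_{n,m})-\mathcal D_x\|\le \tfrac1m .$$ $\mathsf{SampBPP/poly}$ is defined in the same way with fixed advice strings $a_{n,m}\in\{0,1\}^{p(n,m)}$ in place of the distributions $\mathcal D_{n,m}$, and $\mathsf{SampBQP/poly}$, $\mathsf{SampBQP/rpoly}$ are defined in the same way with a polynomial-time quantum algorithm (with classical advice) in place of $A$. **Theorem.** $\mathsf{SampBPP/poly}\ne\mathsf{SampBPP/rpoly}$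 and $\mathsf{SampBQP/poly}\ne\mathsf{SampBQP/rpoly}$. Moreover, for a sequence of nonempty sets $S_n\subseteq\{0,1\}^n$ ($n\ge 0$), consider the problem of outputting, on input $x\in\{0,1\}^n$, a uniformly random element of $S_n$. For every such sequence this problem is in $\mathsf{SampBPP/rpoly}$ and in $\mathsf{SampBQP/rpoly}$. If the $S_n$ are chosen independently, each uniformly at random among the nonempty subsets of $\{0,1\}^n$, then with probability $1$ the problem is neither in $\mathsf{SampBPP/poly}$ nor in $\mathsf{SampBQP/poly}$. -/

import Mathlib

open MeasureTheory

/-! ### Sampling problems -/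

/-- A sampling problem: a probability distribution on binary strings for every input string. -/
abbrev SamplingProblem : Type := List Bool → PMF (List Bool)

/-- Outputs on inputs of length `n` have length at most `p n`, for some polynomial `p`. -/
def SamplingProblem.PolynomiallyBounded (S : SamplingProblem) : Prop :=
  ∃ p : Polynomial ℕ, ∀ x, ∀ z ∈ (S x).support, z.length ≤ p.eval x.length

/-- Total variation distance of two discrete probability distributions. -/
noncomputable def tvDist {α : Type*} (P Q : PMF α) : ℝ :=
  (1 / 2) * ∑' a, |(P a).toReal - (Q a).toReal|

/-! ### Polynomial-time randomized algorithms -/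

/-- The string over `{0, 1, #}` (with `none` as `#`) that lists some words,
each of them terminated by `#`. -/
def encodeWords (ws : List (List Bool)) : List (Option Bool) :=
  ws.flatMap fun w => w.map some ++ [none]

/-- The uniform distribution on `{0,1}^k`. -/
noncomputable def uniformBits (k : ℕ) : PMF (List Bool) :=
  (PMF.uniformOfFintype (Fin k → Bool)).map List.ofFn

/-- The input-output behaviour of an algorithm with inputs `(x, 0^m, y)`, where `y` is an advice
string: the output distribution on every such input. -/
abbrev AdviceAlgorithm : Type := List Bool → ℕ → List Bool → PMF (List Bool)

/-- Encoding of an input `(x, 0^m, y)` together with a string `r` of coin tosses. -/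
def encodeRandomizedInput (i : List Bool × ℕ × List Bool × List Bool) : List (Option Bool) :=
  encodeWords [i.1, List.replicate i.2.1 false, i.2.2.1, i.2.2.2]

/-- `A` is the behaviour of a polynomial-time randomized algorithm: a deterministic
polynomial-time Turing machine that is given the input together with a polynomial number of
independent fair coin tosses. -/
def IsPolyTimeRandomized (A : AdviceAlgorithm) : Prop :=
  ∃ (f : List Bool × ℕ × List Bool × List Bool → List Bool) (q : Polynomial ℕ),
    Nonempty (Turing.TM2ComputableInPolyTime encodeRandomizedInput id f) ∧
    ∀ x m y, A x m y =
      (uniformBits (q.eval (x.length + m + y.length))).map fun r => f (x, m, y, r)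

/-! ### Polynomial-time quantum algorithms -/

/-- The gates Hadamard, `T` (the phase `exp (i π / 4)`) and controlled-NOT on `w` qubits. -/
inductive QGate (w : ℕ) : Type
  | hadamard (i : Fin w) : QGate w
  | tgate (i : Fin w) : QGate w
  | cnot (control target : Fin w) (h : control ≠ target) : QGate w

/-- A vector of `(ℂ²)^{⊗ w}`, by its amplitudes in the computational basis. -/
abbrev QState (w : ℕ) : Type := (Fin w → Bool) → ℂ

/-- The unitary operation of a gate. -/
noncomputable def QGate.apply {w : ℕ} : QGate w → QState w → QState w
  | .hadamard i, ψ => fun b =>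
      ((Real.sqrt 2)⁻¹ : ℂ) *
        (ψ (Function.update b i false) + (if b i then -1 else 1) * ψ (Function.update b i true))
  | .tgate i, ψ => fun b => if b i then Complex.exp (Complex.I * (Real.pi / 4)) * ψ b else ψ b
  | .cnot i j _, ψ => fun b => ψ (Function.update b j (xor (b i) (b j)))

/-- A quantum circuit: the number of qubits, the gates in the order in which they are applied,
and the qubits whose measured values are read as the output, in this order. -/
structure QCircuit where
  width : ℕ
  gates : List (QGate width)
  output : List (Fin width)

/-- The basis state in which qubit `i` holds the `i`-th bit of `s`; all qubits beyond the end
of `s` hold `0`. -/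
noncomputable def QState.basis (w : ℕ) (s : List Bool) : QState w :=
  Pi.single (fun i : Fin w => s.getD i false) 1

/-- The state of the circuit after all of its gates, when `s` is its input. -/
noncomputable def QCircuit.finalState (C : QCircuit) (s : List Bool) : QState C.width :=
  C.gates.foldl (fun ψ g => g.apply ψ) (QState.basis C.width s)

theorem QState.sum_involution {w : ℕ} (σ : (Fin w → Bool) → (Fin w → Bool))
    (hσ : Function.Involutive σ) (g : (Fin w → Bool) → ℝ) : ∑ b, g (σ b) = ∑ b, g b :=
  Equiv.sum_comp hσ.toPerm g

theorem QGate.norm_apply {w : ℕ} (g : QGate w) (ψ : QState w) :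
    ∑ b, ‖g.apply ψ b‖ ^ 2 = ∑ b, ‖ψ b‖ ^ 2 := by
  cases g with
  | hadamard i =>
    have hinv : Function.Involutive
        (fun b : Fin w → Bool => Function.update b i (!(b i))) := by
      intro b; simp
    have key : ∀ b : Fin w → Bool,
        ‖(QGate.hadamard i).apply ψ b‖ ^ 2 +
          ‖(QGate.hadamard i).apply ψ (Function.update b i (!(b i)))‖ ^ 2 =
        ‖ψ b‖ ^ 2 + ‖ψ (Function.update b i (!(b i)))‖ ^ 2 := by
      intro b
      have h2 : ‖((Real.sqrt 2)⁻¹ : ℂ)‖ ^ 2 = 1 / 2 := by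
        rw [norm_inv, Complex.norm_real, Real.norm_eq_abs, inv_pow, sq_abs,
          Real.sq_sqrt (by norm_num)]
        norm_num
      have par : ∀ u v : ℂ, ‖u + v‖ ^ 2 + ‖u - v‖ ^ 2 = 2 * (‖u‖ ^ 2 + ‖v‖ ^ 2) := by
        intro u v
        have := parallelogram_law_with_norm ℝ u v
        nlinarith [this]
      cases hb : b i
      · have e : Function.update b i false = b := by rw [← hb]; simp
        have := par (ψ b) (ψ (Function.update b i true))
        simp only [QGate.apply, hb, Bool.not_false, Function.update_self, Function.update_idem,
          e, norm_mul, mul_pow, h2, if_true, Bool.false_eq_true, if_false, one_mul, neg_mul,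
          ← sub_eq_add_neg]
        linarith
      · have e : Function.update b i true = b := by rw [← hb]; simp
        have := par (ψ (Function.update b i false)) (ψ b)
        simp only [QGate.apply, hb, Bool.not_true, Function.update_self, Function.update_idem,
          e, norm_mul, mul_pow, h2, if_true, Bool.false_eq_true, if_false, one_mul, neg_mul,
          ← sub_eq_add_neg]
        linarith
    have hs := Finset.sum_congr (rfl : (Finset.univ : Finset (Fin w → Bool)) = _)
      (fun b _ => key b)
    rw [Finset.sum_add_distrib, Finset.sum_add_distrib,
      QState.sum_involution _ hinv (fun b => ‖(QGate.hadamard i).apply ψ b‖ ^ 2),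
      QState.sum_involution _ hinv (fun b => ‖ψ b‖ ^ 2)] at hs
    linarith
  | tgate i =>
    refine Finset.sum_congr rfl fun b _ => ?_
    have h : ‖Complex.exp (Complex.I * (Real.pi / 4))‖ = 1 := by
      rw [Complex.norm_exp]; simp
    simp only [QGate.apply]
    split_ifs <;> simp [h]
  | cnot i j hij =>
    refine QState.sum_involution
      (fun b : Fin w → Bool => Function.update b j (xor (b i) (b j))) ?_ (fun b => ‖ψ b‖ ^ 2)
    intro b
    simp [Function.update_of_ne hij]

theorem QCircuit.norm_finalState (C : QCircuit) (s : List Bool) :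
    ∑ b, ‖C.finalState s b‖ ^ 2 = 1 := by
  have h : ∀ (l : List (QGate C.width)) (ψ : QState C.width),
      ∑ b, ‖l.foldl (fun ψ g => g.apply ψ) ψ b‖ ^ 2 = ∑ b, ‖ψ b‖ ^ 2 := by
    intro l
    induction l with
    | nil => intro ψ; rfl
    | cons g l ih => intro ψ; rw [List.foldl_cons, ih, QGate.norm_apply]
  rw [QCircuit.finalState, h]
  rw [Finset.sum_eq_single (fun i : Fin C.width => s.getD i false)]
  · simp [QState.basis]
  · intro b _ hb; rw [QState.basis, Pi.single_eq_of_ne hb]; simp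
  · simp

/-- The distribution of the result when all qubits are measured in the computational basis
at the end. -/
noncomputable def QCircuit.measure (C : QCircuit) (s : List Bool) : PMF (Fin C.width → Bool) :=
  PMF.ofFintype (fun b => ENNReal.ofReal (‖C.finalState s b‖ ^ 2)) (by
    rw [← ENNReal.ofReal_sum_of_nonneg (fun _ _ => by positivity), C.norm_finalState,
      ENNReal.ofReal_one])

/-- The fixed self-delimiting code by which output bits represent a string of arbitrary length:
the bits are read in pairs, `0b` stands for the letter `b` and any other pair for the end. -/
def readOutput : List Bool → List Bool
  | false :: b :: l => b :: readOutput l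
  | _ => []

/-- The distribution of the output string of a circuit on the input `s`. -/
noncomputable def QCircuit.outputDist (C : QCircuit) (s : List Bool) : PMF (List Bool) :=
  (C.measure s).map fun b => readOutput (C.output.map b)

/-- The letters in which circuits are written down. -/
inductive CircuitLetter : Type
  | H | T | C | N | O | tick

/-- Qubit numbers and the number of qubits are written in unary, as sequences of ticks. -/
def unary (k : ℕ) : List CircuitLetter := List.replicate k CircuitLetter.tick

def QGate.encode {w : ℕ} : QGate w → List CircuitLetter
  | .hadamard i => CircuitLetter.H :: unary i
  | .tgate i => CircuitLetter.T :: unary i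
  | .cnot i j _ => CircuitLetter.C :: unary i ++ CircuitLetter.N :: unary j

/-- The description of a circuit as a word. -/
def QCircuit.encode (C : QCircuit) : List CircuitLetter :=
  unary C.width ++ C.gates.flatMap QGate.encode ++
    C.output.flatMap fun i => CircuitLetter.O :: unary i

/-- Encoding of a triple `(n, m, k)` as `0^n # 0^m # 0^k #`. -/
def encodeLengths (i : ℕ × ℕ × ℕ) : List (Option Bool) :=
  encodeWords [List.replicate i.1 false, List.replicate i.2.1 false, List.replicate i.2.2 false]

/-- `A` is the behaviour of a polynomial-time quantum algorithm: a deterministic polynomial-time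
Turing machine constructs from `|x|`, `m`, `|y|` (in unary) a quantum circuit, whose qubits are
initialized with the bits of `x` and `y`, followed by zeros. -/
def IsPolyTimeQuantum (A : AdviceAlgorithm) : Prop :=
  ∃ C : ℕ × ℕ × ℕ → QCircuit,
    Nonempty (Turing.TM2ComputableInPolyTime encodeLengths QCircuit.encode C) ∧
    ∀ x m y, A x m y = (C (x.length, m, y.length)).outputDist (x ++ y)

/-! ### Sampling classes with advice -/

/-- The value `p(n, m)` of a bivariate polynomial. -/
noncomputable def evalPoly (p : MvPolynomial (Fin 2) ℕ) (n m : ℕ) : ℕ :=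
  MvPolynomial.eval ![n, m] p

/-- The sampling problems that are solved by algorithms of a class `𝒜` with the help of
polynomial-size deterministic advice, which depends on the input length `n` and on `m`,
where `1 / m` is the admitted error. -/
def SampPoly (𝒜 : AdviceAlgorithm → Prop) : Set SamplingProblem :=
  {S | S.PolynomiallyBounded ∧
    ∃ (A : AdviceAlgorithm) (p : MvPolynomial (Fin 2) ℕ) (a : ℕ → ℕ → List Bool),
      𝒜 A ∧ (∀ n m, 1 ≤ m → (a n m).length = evalPoly p n m) ∧
      ∀ (x : List Bool) (m : ℕ), 1 ≤ m → tvDist (A x m (a x.length m)) (S x) ≤ 1 / (m : ℝ)}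

/-- The same with randomized advice: the advice string is drawn from a distribution `D n m` on
`{0,1}^{p(n,m)}`. -/
def SampRPoly (𝒜 : AdviceAlgorithm → Prop) : Set SamplingProblem :=
  {S | S.PolynomiallyBounded ∧
    ∃ (A : AdviceAlgorithm) (p : MvPolynomial (Fin 2) ℕ) (D : ℕ → ℕ → PMF (List Bool)),
      𝒜 A ∧ (∀ n m, 1 ≤ m → ∀ y ∈ (D n m).support, y.length = evalPoly p n m) ∧
      ∀ (x : List Bool) (m : ℕ), 1 ≤ m →
        tvDist ((D x.length m).bind fun y => A x m y) (S x) ≤ 1 / (m : ℝ)}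

/-- `SampBPP/poly` -/
def SampBPPpoly : Set SamplingProblem := SampPoly IsPolyTimeRandomized

/-- `SampBPP/rpoly` -/
def SampBPPrpoly : Set SamplingProblem := SampRPoly IsPolyTimeRandomized

/-- `SampBQP/poly` -/
def SampBQPpoly : Set SamplingProblem := SampPoly IsPolyTimeQuantum

/-- `SampBQP/rpoly` -/
def SampBQPrpoly : Set SamplingProblem := SampRPoly IsPolyTimeQuantum

/-! ### Uniform sampling from a randomly chosen set -/

/-- The nonempty subsets of `{0,1}^n`. -/
abbrev NonemptySubset (n : ℕ) : Type := {s : Finset (Fin n → Bool) // s.Nonempty}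

instance NonemptySubset.instNonempty (n : ℕ) : Nonempty (NonemptySubset n) :=
  ⟨⟨Finset.univ, Finset.univ_nonempty⟩⟩

instance NonemptySubset.instMeasurableSpace (n : ℕ) : MeasurableSpace (NonemptySubset n) := ⊤

/-- The problem of sampling uniformly from `S n` on every input of length `n`. -/
noncomputable def uniformProblem (S : (n : ℕ) → NonemptySubset n) : SamplingProblem := fun x =>
  (PMF.uniformOfFinset (S x.length).1 (S x.length).2).map List.ofFn

/-- The law of a sequence of independent sets, the `n`-th of which is uniformly distributed on the
nonempty subsets of `{0,1}^n`. -/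
noncomputable def randomSubsets : Measure ((n : ℕ) → NonemptySubset n) :=
  Measure.infinitePi fun n => (PMF.uniformOfFintype (NonemptySubset n)).toMeasure

/-!
Random advice can hand over a sample of any distribution on short strings, whereas the number of
deterministic advice strings is too small for all the distributions that occur.

For the upper bound, the advice is a uniformly random element of `S n`, suitably coded, and the
algorithm outputs what it is given. Two machines have to be written down for this. In the
randomized case (`AdviceMachine`) the machine outputs its advice in reverse order. In the quantum
case (`ReversalMachine`) it writes down the circuit without gates that measures all of its qubits
and reads them in reverse order; as the input qubits `x` are read last, the end marker of the code
separates them from the advice.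

For the lower bound, fix an algorithm `A` and a polynomial `p` bounding the advice. If the uniform
distributions on two subsets of `{0,1}^n` are close to one and the same output distribution, then
the two sets differ in few places (`card_symmDiff_le`). Hence one advice string serves at most a
fraction `4 ^ (-2 ^ (n - 3))` of all sets (`card_close_le`), and all advice strings of length
`p(n, 32)` together serve a fraction that is arbitrarily small for suitable `n`
(`measure_sampledSets_le`). So almost surely `A` fails with every advice of length `p`.

There are countably many polynomials, and also countably many algorithms
(`countable_tm2Computable`), since a machine can be rewritten over finite types of the form
`Fin n` without changing what it computes. A countable union of null sets is null
(`ae_uniformProblem_notMem_sampPoly`), and both separations follow because the law of the random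
sets is a probability measure.
-/

/-! ### There are only countably many machines -/

namespace Turing.TM2

variable {K K' Λ Λ' σ σ' : Type} {Γ : K → Type} {Γ' : K' → Type}

/-- The symbols, tagged with their stack, that a statement can push. -/
def Stmt.pushed : Stmt Γ Λ σ → Set (Σ k, Γ k)
  | .push k f q => (Set.range fun v => ⟨k, f v⟩) ∪ q.pushed
  | .peek _ _ q => q.pushed
  | .pop _ _ q => q.pushed
  | .load _ q => q.pushed
  | .branch _ q₁ q₂ => q₁.pushed ∪ q₂.pushed
  | .goto _ => ∅
  | .halt => ∅

theorem Stmt.finite_pushed [Finite σ] (q : Stmt Γ Λ σ) : q.pushed.Finite := by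
  induction q with
  | push k f q ih => exact (Set.finite_range _).union ih
  | peek k f q ih => exact ih
  | pop k f q ih => exact ih
  | load f q ih => exact ih
  | branch f q₁ q₂ ih₁ ih₂ => exact ih₁.union ih₂
  | goto f => exact Set.finite_empty
  | halt => exact Set.finite_empty

/-- The nesting depth of a statement. -/
def Stmt.depth : Stmt Γ Λ σ → ℕ
  | .push _ _ q => q.depth + 1
  | .peek _ _ q => q.depth + 1
  | .pop _ _ q => q.depth + 1
  | .load _ q => q.depth + 1
  | .branch _ q₁ q₂ => max q₁.depth q₂.depth + 1
  | .goto _ => 0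
  | .halt => 0

theorem Stmt.countable_depth_le [Countable K] [∀ k, Finite (Γ k)] [Finite σ] [Countable Λ]
    (n : ℕ) : {q : Stmt Γ Λ σ | q.depth ≤ n}.Countable := by
  induction n with
  | zero =>
    refine (((Set.countable_range (fun f : σ → Λ => (Stmt.goto f : Stmt Γ Λ σ))).union
      (Set.countable_singleton Stmt.halt))).mono fun q hq => ?_
    cases q <;> simp_all [Stmt.depth]
  | succ n ih =>
    let D := {q : Stmt Γ Λ σ | q.depth ≤ n}
    have h : ({q : Stmt Γ Λ σ | q.depth ≤ n + 1}) ⊆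
        (⋃ k : K, ⋃ f : σ → Γ k, Stmt.push k f '' D) ∪
        (⋃ k : K, ⋃ f : σ → Option (Γ k) → σ, Stmt.peek k f '' D) ∪
        (⋃ k : K, ⋃ f : σ → Option (Γ k) → σ, Stmt.pop k f '' D) ∪
        (⋃ f : σ → σ, Stmt.load f '' D) ∪
        (⋃ f : σ → Bool, Set.image2 (Stmt.branch f) D D) ∪
        Set.range (fun f : σ → Λ => (Stmt.goto f : Stmt Γ Λ σ)) ∪ {Stmt.halt} := by
      intro q hq
      simp only [Set.mem_union, Set.mem_iUnion, Set.mem_singleton_iff]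
      have hn : ∀ a, a + 1 ≤ n + 1 → a ≤ n := fun _ => Nat.le_of_succ_le_succ
      cases q with
      | push k f q => exact .inl (.inl (.inl (.inl (.inl (.inl ⟨k, f, q, hn _ hq, rfl⟩)))))
      | peek k f q => exact .inl (.inl (.inl (.inl (.inl (.inr ⟨k, f, q, hn _ hq, rfl⟩)))))
      | pop k f q => exact .inl (.inl (.inl (.inl (.inr ⟨k, f, q, hn _ hq, rfl⟩))))
      | load f q => exact .inl (.inl (.inl (.inr ⟨f, q, hn _ hq, rfl⟩)))
      | branch f q₁ q₂ =>
        have hm : max q₁.depth q₂.depth ≤ n := hn _ hq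
        exact .inl (.inl (.inr ⟨f, q₁, (le_max_left _ _).trans hm, q₂,
          (le_max_right _ _).trans hm, rfl⟩))
      | goto f => exact .inl (.inr ⟨f, rfl⟩)
      | halt => exact .inr rfl
    refine Set.Countable.mono h ?_
    refine (((((((?_ : Set.Countable _).union ?_).union ?_).union ?_).union ?_).union
      (Set.countable_range _)).union (Set.countable_singleton _))
    · exact Set.countable_iUnion fun k => Set.countable_iUnion fun f => ih.image _
    · exact Set.countable_iUnion fun k => Set.countable_iUnion fun f => ih.image _
    · exact Set.countable_iUnion fun k => Set.countable_iUnion fun f => ih.image _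
    · exact Set.countable_iUnion fun f => ih.image _
    · exact Set.countable_iUnion fun f => ih.image2 ih _

instance Stmt.instCountable [Countable K] [∀ k, Finite (Γ k)] [Finite σ] [Countable Λ] :
    Countable (Stmt Γ Λ σ) := by
  rw [← Set.countable_univ_iff]
  refine (Set.countable_iUnion fun n => Stmt.countable_depth_le n).mono fun q _ => ?_
  exact Set.mem_iUnion.2 ⟨q.depth, le_refl q.depth⟩

section Simulation

variable (e : K' ≃ K) (l : Λ' ≃ Λ) (s : σ' ≃ σ) (ι : ∀ k, Γ' k → Γ (e k))

/-- The contents of the stacks agree after translation of the symbols. -/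
def StkRel (S' : ∀ k, List (Γ' k)) (S : ∀ k, List (Γ k)) : Prop :=
  ∀ k, S (e k) = (S' k).map (ι k)

/-- Two configurations agree after translation of stacks, symbols, labels and states. -/
def CfgRel (c' : Cfg Γ' Λ' σ') (c : Cfg Γ Λ σ) : Prop :=
  c.l = c'.l.map l ∧ c.var = s c'.var ∧ StkRel e ι c'.stk c.stk

variable [DecidableEq K] [DecidableEq K']

theorem StkRel.update {e : K' ≃ K} {ι : ∀ k, Γ' k → Γ (e k)} {S' : ∀ k, List (Γ' k)}
    {S : ∀ k, List (Γ k)} (h : StkRel e ι S' S) {k : K'} {a' : List (Γ' k)} {a : List (Γ (e k))}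
    (ha : a = a'.map (ι k)) :
    StkRel e ι (Function.update S' k a') (Function.update S (e k) a) := by
  intro j
  by_cases hj : j = k
  · subst hj; simp [ha]
  · rw [Function.update_of_ne hj, Function.update_of_ne (e.injective.ne hj), h j]

/-- Executing the two statements preserves the translation of configurations. -/
def Simulates (q' : Stmt Γ' Λ' σ') (q : Stmt Γ Λ σ) : Prop :=
  ∀ v S' S, StkRel e ι S' S → CfgRel e l s ι (stepAux q' v S') (stepAux q (s v) S)

/-- A statement can be rewritten over any alphabets that cover the symbols it pushes. -/
theorem exists_simulates (q : Stmt Γ Λ σ)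
    (h : ∀ k a, ⟨e k, a⟩ ∈ q.pushed → a ∈ Set.range (ι k)) :
    ∃ q' : Stmt Γ' Λ' σ', Simulates e l s ι q' q := by
  induction q with
  | push k f q ih =>
    obtain ⟨k, rfl⟩ := e.surjective k
    obtain ⟨q', hq⟩ := ih fun k a ha => h k a (Or.inr ha)
    have hf : ∀ v, ∃ a, ι k a = f (s v) := fun v => h k _ (Or.inl ⟨s v, rfl⟩)
    choose f' hf' using hf
    refine ⟨.push k f' q', fun v S' S hS => hq _ _ _ (hS.update ?_)⟩
    rw [hS k, List.map_cons, hf']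
  | peek k f q ih =>
    obtain ⟨k, rfl⟩ := e.surjective k
    obtain ⟨q', hq⟩ := ih h
    refine ⟨.peek k (fun v o => s.symm (f (s v) (o.map (ι k)))) q', fun v S' S hS => ?_⟩
    have := hq (s.symm (f (s v) ((S' k).head?.map (ι k)))) S' S hS
    rw [Equiv.apply_symm_apply, ← List.head?_map, ← hS k] at this
    simpa only [stepAux, ← List.head?_map, ← hS k] using this
  | pop k f q ih =>
    obtain ⟨k, rfl⟩ := e.surjective k
    obtain ⟨q', hq⟩ := ih h
    refine ⟨.pop k (fun v o => s.symm (f (s v) (o.map (ι k)))) q', fun v S' S hS => ?_⟩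
    have ht : (S (e k)).tail = ((S' k).tail).map (ι k) := by rw [hS k, List.map_tail]
    have := hq (s.symm (f (s v) ((S' k).head?.map (ι k)))) _ _ (hS.update ht)
    rw [Equiv.apply_symm_apply, ← List.head?_map, ← hS k] at this
    simpa only [stepAux, ← List.head?_map, ← hS k] using this
  | load f q ih =>
    obtain ⟨q', hq⟩ := ih h
    refine ⟨.load (fun v => s.symm (f (s v))) q', fun v S' S hS => ?_⟩
    have := hq (s.symm (f (s v))) S' S hS
    rwa [Equiv.apply_symm_apply] at this
  | branch f q₁ q₂ ih₁ ih₂ =>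
    obtain ⟨q₁', hq₁⟩ := ih₁ fun k a ha => h k a (Or.inl ha)
    obtain ⟨q₂', hq₂⟩ := ih₂ fun k a ha => h k a (Or.inr ha)
    refine ⟨.branch (fun v => f (s v)) q₁' q₂', fun v S' S hS => ?_⟩
    simp only [stepAux]
    cases f (s v)
    · exact hq₂ _ _ _ hS
    · exact hq₁ _ _ _ hS
  | goto f =>
    exact ⟨.goto fun v => l.symm (f (s v)), fun v S' S hS => ⟨by simp, rfl, hS⟩⟩
  | halt => exact ⟨.halt, fun v S' S hS => ⟨rfl, rfl, hS⟩⟩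

theorem respects_of_simulates {M' : Λ' → Stmt Γ' Λ' σ'} {M : Λ → Stmt Γ Λ σ}
    (h : ∀ i, Simulates e l s ι (M' i) (M (l i))) :
    StateTransition.Respects (step M') (step M) (CfgRel e l s ι) := by
  rintro ⟨i, v, S'⟩ ⟨j, w, S⟩ ⟨h₁, h₂, h₃⟩
  dsimp only at h₁ h₂ h₃
  subst h₁ h₂
  cases i with
  | none => rfl
  | some i => exact ⟨_, h i v S' S h₃, Relation.TransGen.single rfl⟩

end Simulation

/-- The machine with program `M` computes `f` up to the encodings `ea` of inputs and `eb` of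
outputs, whose letters are translated by `inp` and `out`. There is no bound on the time, and only
the contents of the output stack matter. -/
def Computes [DecidableEq K] {α β αΓ βΓ : Type} (ea : α → List αΓ) (eb : β → List βΓ)
    (M : Λ → Stmt Γ Λ σ) (i : Λ) (v : σ) (k₀ k₁ : K) (inp : αΓ → Γ k₀) (out : Γ k₁ → βΓ)
    (f : α → β) : Prop :=
  ∀ a, ∃ c ∈ StateTransition.eval (step M)
      ⟨some i, v, Function.update (fun _ => []) k₀ ((ea a).map inp)⟩,
    (c.stk k₁).map out = eb (f a)

theorem subsingleton_computes [DecidableEq K] {α β αΓ βΓ : Type} (ea : α → List αΓ)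
    {eb : β → List βΓ} (hb : Function.Injective eb)
    (M : Λ → Stmt Γ Λ σ) (i : Λ) (v : σ) (k₀ k₁ : K) (inp : αΓ → Γ k₀) (out : Γ k₁ → βΓ) :
    {f | Computes ea eb M i v k₀ k₁ inp out f}.Subsingleton := by
  intro f hf g hg
  funext a
  obtain ⟨c, hc, h⟩ := hf a
  obtain ⟨d, hd, h'⟩ := hg a
  obtain rfl := Part.mem_unique hc hd
  exact hb (h.symm.trans h')

end Turing.TM2

theorem StateTransition.EvalsTo.reaches {σ : Type*} {f : σ → Option σ} {a b : σ}
    (h : StateTransition.EvalsTo f a (some b)) : StateTransition.Reaches f a b := by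
  obtain ⟨n, hn⟩ := h
  induction n generalizing a with
  | zero => cases hn; exact Relation.ReflTransGen.refl
  | succ n ih =>
    rw [Function.iterate_succ_apply] at hn
    have hnone : ∀ n, (flip bind f)^[n] none = none := fun n => Function.iterate_fixed rfl n
    cases hf : f a with
    | none =>
      rw [show flip bind f (some a) = none from hf, hnone] at hn
      cases hn
    | some c =>
      rw [show flip bind f (some a) = some c from hf] at hn
      exact Relation.ReflTransGen.head hf (ih hn)

open Turing.TM2 in
/-- A machine is determined up to renaming by finite data: although only the alphabet of the input
stack is required to be finite, a program pushes finitely many symbols. -/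
theorem Turing.TM2Computable.exists_computes {α β αΓ βΓ : Type} {ea : α → List αΓ}
    {eb : β → List βΓ} {f : α → β} (h : Turing.TM2Computable ea eb f) :
    ∃ (κ Λ σ : ℕ) (g : Fin κ → ℕ)
      (M : Fin Λ → Turing.TM2.Stmt (fun k => Fin (g k)) (Fin Λ) (Fin σ))
      (i : Fin Λ) (v : Fin σ) (k₀ k₁ : Fin κ) (inp : αΓ → Fin (g k₀)) (out : Fin (g k₁) → βΓ),
      Computes ea eb M i v k₀ k₁ inp out f := by
  obtain ⟨⟨⟨k₀, k₁, Γ, Λ, main, σ, v, M⟩, inE, outE⟩, hf⟩ := h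
  rename_i K _ _ _ _ _
  dsimp only at inE outE
  obtain ⟨κ, ⟨e⟩⟩ := Finite.exists_equiv_fin K
  obtain ⟨nΛ, ⟨l⟩⟩ := Finite.exists_equiv_fin Λ
  obtain ⟨nσ, ⟨s⟩⟩ := Finite.exists_equiv_fin σ
  let e := e.symm; let l := l.symm; let s := s.symm
  obtain ⟨k₀, rfl⟩ := e.surjective k₀
  obtain ⟨k₁, rfl⟩ := e.surjective k₁
  -- All symbols that occur on some stack during a run: those pushed and those of the input.
  let P : Set (Σ k, Γ k) := (⋃ i, (M i).pushed) ∪ Set.range fun a => ⟨e k₀, a⟩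
  have hP : P.Finite := by
    have : Finite (Γ (e k₀)) := inferInstance
    exact (Set.finite_iUnion fun i => (M i).finite_pushed).union (Set.finite_range _)
  have hU : ∀ k : Fin κ, ∃ (n : ℕ) (ι : Fin n → Γ (e k)), ∀ a, ⟨e k, a⟩ ∈ P → a ∈ Set.range ι := by
    intro k
    have hfin : {a : Γ (e k) | (⟨e k, a⟩ : Σ k, Γ k) ∈ P}.Finite :=
      hP.preimage sigma_mk_injective.injOn
    have := hfin.to_subtype
    obtain ⟨n, ⟨u⟩⟩ := Finite.exists_equiv_fin {a : Γ (e k) | (⟨e k, a⟩ : Σ k, Γ k) ∈ P}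
    exact ⟨n, fun i => (u.symm i).1, fun a ha => ⟨u ⟨a, ha⟩, by simp⟩⟩
  choose g ι hι using hU
  have hsim : ∀ i, ∃ q' : Stmt (fun k => Fin (g k)) (Fin nΛ) (Fin nσ),
      Simulates e l s ι q' (M (l i)) := fun i =>
    exists_simulates e l s ι (M (l i)) fun k a ha =>
      hι k a (Or.inl (Set.mem_iUnion.2 ⟨l i, ha⟩))
  choose M' hM' using hsim
  have hin : ∀ a, ∃ i, ι k₀ i = inE.symm a := fun a => hι k₀ _ (Or.inr ⟨_, rfl⟩)
  choose inp hinp using hin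
  refine ⟨κ, nΛ, nσ, g, M', l.symm main, s.symm v, k₀, k₁, inp, fun i => outE (ι k₁ i),
    fun a => ?_⟩
  -- The run of the given machine is pulled back along the simulation by the renamed one.
  have hev := StateTransition.mem_eval.2 ⟨(hf a).reaches, rfl⟩
  obtain ⟨c, hc, hc'⟩ := StateTransition.tr_eval_rev (respects_of_simulates e l s ι hM')
    (a₁ := ⟨some (l.symm main), s.symm v, Function.update (fun _ => []) k₀ ((ea a).map inp)⟩)
    ⟨by simp [Turing.initList], by simp [Turing.initList], by
      intro k
      by_cases hk : k = k₀
      · subst hk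
        simp [Turing.initList, Function.comp_def, hinp]
      · simp [Turing.initList, hk]⟩ hev
  refine ⟨c, hc', ?_⟩
  have h := hc.2.2 k₁
  simp only [Turing.haltList, dif_pos] at h
  simpa [Function.comp_def] using (congrArg (List.map outE) h).symm

open Turing.TM2 in
theorem countable_tm2Computable {α β αΓ βΓ : Type} [Finite αΓ] [Countable βΓ] (ea : α → List αΓ)
    {eb : β → List βΓ} (hb : Function.Injective eb) :
    {f : α → β | Nonempty (Turing.TM2Computable ea eb f)}.Countable := by
  have hsub : {f : α → β | Nonempty (Turing.TM2Computable ea eb f)} ⊆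
      ⋃ (κ : ℕ) (nΛ : ℕ) (nσ : ℕ) (g : Fin κ → ℕ)
        (M : Fin nΛ → Stmt (fun k => Fin (g k)) (Fin nΛ) (Fin nσ))
        (i : Fin nΛ) (v : Fin nσ) (k₀ : Fin κ) (k₁ : Fin κ) (inp : αΓ → Fin (g k₀))
        (out : Fin (g k₁) → βΓ), {f | Computes ea eb M i v k₀ k₁ inp out f} := by
    rintro f ⟨h⟩
    simpa only [Set.mem_iUnion, Set.mem_ofPred_eq] using h.exists_computes
  refine Set.Countable.mono hsub ?_
  iterate 11 refine Set.countable_iUnion fun _ => ?_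
  exact (subsingleton_computes ea hb _ _ _ _ _ _ _).countable

/-! ### The classes contain countably many algorithms -/

theorem unary_append_inj {k k' : ℕ} {r r' : List CircuitLetter} (hr : r.head? ≠ some .tick)
    (hr' : r'.head? ≠ some .tick) (h : unary k ++ r = unary k' ++ r') : k = k' ∧ r = r' := by
  induction k generalizing k' with
  | zero =>
    cases k' with
    | zero => exact ⟨rfl, h⟩
    | succ k' =>
      obtain rfl : r = _ := h
      simp [unary, List.replicate_succ] at hr
  | succ k ih =>
    cases k' with
    | zero =>
      obtain rfl : _ = r' := h
      simp [unary, List.replicate_succ] at hr'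
    | succ k' =>
      have h' : CircuitLetter.tick :: (unary k ++ r) = CircuitLetter.tick :: (unary k' ++ r') := h
      obtain ⟨h₁, h₂⟩ := ih (List.cons.inj h').2
      exact ⟨by rw [h₁], h₂⟩

theorem head?_encode_output (o : List ℕ) :
    (o.flatMap fun i => CircuitLetter.O :: unary i).head? ≠ some .tick := by
  cases o <;> simp

theorem encode_output_injective :
    Function.Injective fun o : List ℕ => o.flatMap fun i => CircuitLetter.O :: unary i := by
  intro o o' h
  induction o generalizing o' with
  | nil => cases o' <;> simp_all
  | cons i o ih =>
    cases o' with
    | nil => simp at h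
    | cons i' o' =>
      simp only [List.flatMap_cons, List.cons_append, List.cons.injEq, true_and] at h
      obtain ⟨h₁, h₂⟩ :=
        unary_append_inj (head?_encode_output o) (head?_encode_output o') h
      rw [h₁, ih h₂]

theorem head?_encode_gates {w : ℕ} (g : List (QGate w)) (o : List ℕ) :
    (g.flatMap QGate.encode ++ o.flatMap fun i => CircuitLetter.O :: unary i).head? ≠
      some .tick := by
  rcases g with _ | ⟨_ | _ | _, g⟩
  · exact head?_encode_output o
  all_goals simp [QGate.encode]

theorem encode_gates_inj {w : ℕ} {g g' : List (QGate w)} {o o' : List ℕ}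
    (h : (g.flatMap QGate.encode ++ o.flatMap fun i => CircuitLetter.O :: unary i) =
      g'.flatMap QGate.encode ++ o'.flatMap fun i => CircuitLetter.O :: unary i) :
    g = g' ∧ o = o' := by
  induction g generalizing g' with
  | nil =>
    rcases g' with _ | ⟨_ | _ | _, g'⟩
    · exact ⟨rfl, encode_output_injective h⟩
    all_goals cases o <;> simp [QGate.encode] at h
  | cons a g ih =>
    rcases g' with _ | ⟨b, g'⟩
    · cases a <;> cases o' <;> simp [QGate.encode] at h
    · cases a <;> cases b <;>
        simp only [List.flatMap_cons, List.cons_append, List.cons.injEq, QGate.encode,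
          List.append_assoc, reduceCtorEq, false_and, true_and] at h
      · obtain ⟨h₁, h₂⟩ := unary_append_inj (head?_encode_gates g o) (head?_encode_gates g' o') h
        obtain ⟨rfl, rfl⟩ := ih h₂
        rw [Fin.ext h₁]
        exact ⟨rfl, rfl⟩
      · obtain ⟨h₁, h₂⟩ := unary_append_inj (head?_encode_gates g o) (head?_encode_gates g' o') h
        obtain ⟨rfl, rfl⟩ := ih h₂
        rw [Fin.ext h₁]
        exact ⟨rfl, rfl⟩
      · obtain ⟨h₁, h₂⟩ := unary_append_inj (by simp) (by simp) h
        obtain ⟨h₃, h₄⟩ := unary_append_inj (head?_encode_gates g o) (head?_encode_gates g' o')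
          (List.cons.inj h₂).2
        obtain ⟨rfl, rfl⟩ := ih h₄
        obtain rfl := Fin.ext h₁
        obtain rfl := Fin.ext h₃
        exact ⟨rfl, rfl⟩

/-- In the definition of `QCircuit.encode` the list of output qubits is coerced to a list of numbers
as a whole. -/
theorem QCircuit.encode_eq (C : QCircuit) :
    C.encode = unary C.width ++ (C.gates.flatMap QGate.encode ++
      (C.output.map Fin.val).flatMap fun i => CircuitLetter.O :: unary i) := by
  simp [QCircuit.encode, List.flatMap_map, List.flatMap_assoc]

theorem QCircuit.encode_injective : Function.Injective QCircuit.encode := by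
  rintro ⟨w, g, o⟩ ⟨w', g', o'⟩ h
  rw [QCircuit.encode_eq, QCircuit.encode_eq] at h
  obtain ⟨rfl, h⟩ := unary_append_inj (head?_encode_gates _ _) (head?_encode_gates _ _) h
  obtain ⟨rfl, h⟩ := encode_gates_inj h
  obtain rfl : o = o' := Fin.val_injective.list_map h
  rfl

instance CircuitLetter.instCountable : Countable CircuitLetter :=
  Function.Injective.countable (f := CircuitLetter.ctorIdx) fun a b h => by
    cases a <;> cases b <;> first | rfl | cases h

instance Polynomial.instCountableNat : Countable (Polynomial ℕ) := by
  rw [← Cardinal.mk_le_aleph0_iff]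
  exact Polynomial.cardinalMk_le_max.trans (by simp)

instance MvPolynomial.instCountableNat : Countable (MvPolynomial (Fin 2) ℕ) := by
  rw [← Cardinal.mk_le_aleph0_iff]
  exact MvPolynomial.cardinalMk_le_max.trans (by simp)

theorem countable_isPolyTimeRandomized : {A | IsPolyTimeRandomized A}.Countable := by
  let F : (List Bool × ℕ × List Bool × List Bool → List Bool) → Polynomial ℕ → AdviceAlgorithm :=
    fun f q x m y => (uniformBits (q.eval (x.length + m + y.length))).map fun r => f (x, m, y, r)
  refine ((countable_tm2Computable encodeRandomizedInput
    (eb := (id : List Bool → List Bool)) Function.injective_id).image2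
      (Set.countable_univ (α := Polynomial ℕ)) F).mono ?_
  rintro A ⟨f, q, ⟨h⟩, hA⟩
  refine ⟨f, ⟨h.toTM2ComputableInTime.toTM2Computable⟩, q, trivial, ?_⟩
  funext x m y
  exact (hA x m y).symm

theorem countable_isPolyTimeQuantum : {A | IsPolyTimeQuantum A}.Countable := by
  let F : (ℕ × ℕ × ℕ → QCircuit) → AdviceAlgorithm :=
    fun C x m y => (C (x.length, m, y.length)).outputDist (x ++ y)
  refine ((countable_tm2Computable encodeLengths QCircuit.encode_injective).image F).mono ?_
  rintro A ⟨C, ⟨h⟩, hA⟩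
  refine ⟨C, ⟨h.toTM2ComputableInTime.toTM2Computable⟩, ?_⟩
  funext x m y
  exact (hA x m y).symm

/-! ### Total variation distance -/

theorem PMF.summable_toReal {α : Type*} (P : PMF α) : Summable fun a => (P a).toReal :=
  ENNReal.summable_toReal P.tsum_coe_ne_top

theorem summable_abs_sub {α : Type*} (P Q : PMF α) :
    Summable fun a => |(P a).toReal - (Q a).toReal| :=
  (P.summable_toReal.sub Q.summable_toReal).abs

theorem tvDist_self {α : Type*} (P : PMF α) : tvDist P P = 0 := by
  simp [tvDist]

theorem tvDist_triangle_left {α : Type*} (P Q R : PMF α) :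
    tvDist Q R ≤ tvDist P Q + tvDist P R := by
  unfold tvDist
  rw [← mul_add, ← (summable_abs_sub P Q).tsum_add (summable_abs_sub P R)]
  refine mul_le_mul_of_nonneg_left ?_ (by norm_num)
  refine (summable_abs_sub Q R).tsum_le_tsum (fun a => ?_)
    ((summable_abs_sub P Q).add (summable_abs_sub P R))
  rw [abs_sub_comm (P a).toReal (Q a).toReal]
  exact abs_sub_le _ _ _

theorem sum_abs_sub_le_tvDist_map {α β : Type*} (P Q : PMF α) {f : α → β}
    (hf : Function.Injective f) (s : Finset α) :
    ∑ a ∈ s, |(P a).toReal - (Q a).toReal| ≤ 2 * tvDist (P.map f) (Q.map f) := by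
  have hmap : ∀ (R : PMF α) (a : α), R.map f (f a) = R a := by
    intro R a
    classical
    rw [PMF.map_apply, tsum_eq_single a fun b hb => if_neg fun h => hb (hf h).symm, if_pos rfl]
  have h := (summable_abs_sub (P.map f) (Q.map f)).sum_le_tsum (s.map ⟨f, hf⟩)
    fun _ _ => abs_nonneg _
  rw [Finset.sum_map] at h
  simp only [Function.Embedding.coeFn_mk, hmap] at h
  rw [tvDist]
  linarith

/-- The uniform distributions on two sets differ by at least `1 / |α|` at every point at which the
sets differ. -/
theorem card_symmDiff_le {α β : Type*} [Fintype α] [DecidableEq α] {f : α → β}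
    (hf : Function.Injective f) {S T : Finset α} (hS : S.Nonempty) (hT : T.Nonempty) :
    ((symmDiff S T).card : ℝ) ≤ Fintype.card α *
      (2 * tvDist ((PMF.uniformOfFinset S hS).map f) ((PMF.uniformOfFinset T hT).map f)) := by
  have hN : (0 : ℝ) < Fintype.card α := by
    obtain ⟨a, -⟩ := hS
    exact_mod_cast Fintype.card_pos_iff.2 ⟨a⟩
  have hinv : ∀ U : Finset α, U.Nonempty → (Fintype.card α : ℝ)⁻¹ ≤ (U.card : ℝ)⁻¹ := by
    intro U hU
    have : (0 : ℝ) < U.card := by exact_mod_cast hU.card_pos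
    exact inv_anti₀ this (by exact_mod_cast U.card_le_univ)
  have h := sum_abs_sub_le_tvDist_map (PMF.uniformOfFinset S hS) (PMF.uniformOfFinset T hT) hf
    (symmDiff S T)
  have h₁ : ∑ _a ∈ symmDiff S T, (Fintype.card α : ℝ)⁻¹ ≤ _ :=
    (Finset.sum_le_sum fun a ha => ?_).trans h
  · rw [Finset.sum_const, nsmul_eq_mul, ← div_eq_mul_inv, div_le_iff₀ hN] at h₁
    linarith
  · rcases Finset.mem_symmDiff.1 ha with ⟨h₁, h₂⟩ | ⟨h₁, h₂⟩
    · simpa [PMF.uniformOfFinset_apply, h₁, h₂] using hinv S hS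
    · simpa [PMF.uniformOfFinset_apply, h₁, h₂] using hinv T hT

/-! ### Few sets are close to a given distribution -/

/-- A Chernoff-type bound: weighting every subset `T` by `2 ^ (-|T|)` gives total weight
`(3 / 2) ^ N`, and each of the counted sets has weight at least `2 ^ (-k)`. -/
theorem card_filter_card_le {α : Type*} [Fintype α] (k : ℕ) :
    ((Finset.univ.filter fun T : Finset α => T.card ≤ k).card : ℝ) ≤
      2 ^ k * (3 / 2) ^ Fintype.card α := by
  have h := Finset.sum_pow_mul_eq_add_pow (1 / 2 : ℝ) 1 (Finset.univ : Finset α)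
  simp only [one_pow, mul_one, Finset.powerset_univ, Finset.card_univ] at h
  rw [show (1 / 2 + 1 : ℝ) = 3 / 2 by norm_num] at h
  rw [← h, Finset.mul_sum]
  calc ((Finset.univ.filter fun T : Finset α => T.card ≤ k).card : ℝ)
      = ∑ T ∈ Finset.univ.filter fun T : Finset α => T.card ≤ k, (1 : ℝ) := by simp
    _ ≤ ∑ T ∈ Finset.univ.filter fun T : Finset α => T.card ≤ k,
          (2 : ℝ) ^ k * (1 / 2) ^ T.card := by
        refine Finset.sum_le_sum fun T hT => ?_
        have hT : T.card ≤ k := (Finset.mem_filter.1 hT).2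
        rw [div_pow, one_pow, mul_one_div, le_div_iff₀ (by positivity), one_mul]
        exact pow_le_pow_right₀ (by norm_num) hT
    _ ≤ _ := Finset.sum_le_sum_of_subset_of_nonneg (Finset.filter_subset _ _)
        fun _ _ _ => by positivity

/-- Among the subsets of a set with `8 M` elements, at most a fraction `4 ^ (-M)` has a uniform
distribution that is close to a given distribution `P`: all of them differ from any single one in at
most `M` places, and `2 ^ M * (3 / 4) ^ (8 * M) ≤ 4 ^ (-M)`. -/
theorem card_close_le {α β : Type*} [Fintype α] {M : ℕ} (hM : Fintype.card α = 8 * M)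
    {f : α → β} (hf : Function.Injective f) (P : PMF β)
    (F : Finset {s : Finset α // s.Nonempty})
    (hF : ∀ S ∈ F, tvDist P ((PMF.uniformOfFinset S.1 S.2).map f) ≤ 1 / 32) :
    (F.card : ℝ) * 4 ^ M ≤ 2 ^ Fintype.card α := by
  classical
  rcases F.eq_empty_or_nonempty with rfl | ⟨S₀, hS₀⟩
  · simp
  have hsub : F.card ≤ (Finset.univ.filter fun T : Finset α => T.card ≤ M).card := by
    refine Finset.card_le_card_of_injOn (fun S => symmDiff S₀.1 S.1) (fun S hS => ?_) ?_
    · have h₁ := tvDist_triangle_left P ((PMF.uniformOfFinset S₀.1 S₀.2).map f)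
        ((PMF.uniformOfFinset S.1 S.2).map f)
      have h₂ := card_symmDiff_le hf S₀.2 S.2
      -- Both distances to `P` are at most `1 / 32`, which leaves `2 * (1 / 32 + 1 / 32) = 1 / 8`.
      have h₃ : ((symmDiff S₀.1 S.1).card : ℝ) ≤ Fintype.card α * (1 / 8) :=
        h₂.trans (mul_le_mul_of_nonneg_left (by linarith [hF _ hS₀, hF _ hS]) (by positivity))
      rw [hM] at h₃
      push_cast at h₃
      have h₄ : ((symmDiff S₀.1 S.1).card : ℝ) ≤ M := by linarith
      simpa using h₄
    · exact fun S _ T _ h => Subtype.ext (symmDiff_right_injective _ h)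
  have hc := card_filter_card_le (α := α) M
  have hF' : (F.card : ℝ) ≤ 2 ^ M * (3 / 2) ^ Fintype.card α :=
    le_trans (by exact_mod_cast hsub) hc
  calc (F.card : ℝ) * 4 ^ M ≤ 2 ^ M * (3 / 2) ^ Fintype.card α * 4 ^ M := by gcongr
    _ = (2 * (3 / 2) ^ 8 * 4) ^ M := by rw [hM, pow_mul, ← mul_pow, ← mul_pow]
    _ ≤ (2 ^ 8) ^ M := by gcongr; norm_num
    _ = 2 ^ Fintype.card α := by rw [hM, pow_mul]

/-! ### Random sets are hard -/

theorem exists_evalPoly_le (p : MvPolynomial (Fin 2) ℕ) (m : ℕ) :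
    ∃ c d : ℕ, ∀ n, evalPoly p n m ≤ c * (n + 1) ^ d := by
  unfold evalPoly
  induction p using MvPolynomial.induction_on with
  | C a => exact ⟨a, 0, fun n => by simp⟩
  | add p q hp hq =>
    obtain ⟨c, d, h⟩ := hp
    obtain ⟨c', d', h'⟩ := hq
    refine ⟨c + c', max d d', fun n => ?_⟩
    rw [map_add, add_mul]
    have h₁ : (n + 1) ^ d ≤ (n + 1) ^ max d d' :=
      Nat.pow_le_pow_right n.succ_pos (le_max_left _ _)
    have h₂ : (n + 1) ^ d' ≤ (n + 1) ^ max d d' :=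
      Nat.pow_le_pow_right n.succ_pos (le_max_right _ _)
    exact add_le_add ((h n).trans (Nat.mul_le_mul_left _ h₁))
      ((h' n).trans (Nat.mul_le_mul_left _ h₂))
  | mul_X p i hp =>
    obtain ⟨c, d, h⟩ := hp
    refine ⟨c * (m + 1), d + 1, fun n => ?_⟩
    have hi : (![n, m] : Fin 2 → ℕ) i ≤ (m + 1) * (n + 1) := by
      fin_cases i
      · show n ≤ _
        nlinarith
      · show m ≤ _
        nlinarith
    rw [map_mul, MvPolynomial.eval_X]
    calc _ ≤ c * (n + 1) ^ d * ((m + 1) * (n + 1)) := Nat.mul_le_mul (h n) hi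
      _ = c * (m + 1) * (n + 1) ^ (d + 1) := by ring

theorem exists_evalPoly_add_le_two_pow (p : MvPolynomial (Fin 2) ℕ) (m j : ℕ) :
    ∃ k, evalPoly p (k + 3) m + j ≤ 2 ^ k := by
  obtain ⟨c, d, h⟩ := exists_evalPoly_le p m
  have ht := (tendsto_pow_const_div_const_pow_of_one_lt d (one_lt_two (α := ℝ))).comp
    (Filter.tendsto_add_atTop_nat 4)
  -- The constant absorbs `c`, `j` and the factor `2 ^ 4` between `2 ^ (k + 4)` and `2 ^ k`.
  have hev := ht.eventually (gt_mem_nhds (show (0 : ℝ) < 1 / (32 * (c + j + 1)) by positivity))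
  obtain ⟨k, hk⟩ := hev.exists
  refine ⟨k, ?_⟩
  simp only [Function.comp_apply] at hk
  rw [div_lt_div_iff₀ (by positivity) (by positivity), one_mul, pow_add] at hk
  have hk' : (k + 4) ^ d * (32 * (c + j + 1)) < 2 ^ k * 2 ^ 4 := by exact_mod_cast hk
  have h₁ : 1 ≤ (k + 4) ^ d := Nat.one_le_pow _ _ (by omega)
  have h₂ := h (k + 3)
  rw [show k + 3 + 1 = k + 4 by ring] at h₂
  have h₃ : j ≤ j * (k + 4) ^ d := Nat.le_mul_of_pos_right _ h₁
  nlinarith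

theorem uniformProblem_eq {S : (n : ℕ) → NonemptySubset n} {x : List Bool} {n : ℕ}
    (h : x.length = n) :
    uniformProblem S x = (PMF.uniformOfFinset (S n).1 (S n).2).map List.ofFn := by
  subst h
  rfl

/-- The nonempty subsets of `{0,1}^n` that `A`, run with error bound `1 / m` on the input `0^n` and
with some advice string of length `L`, samples with error at most `1 / m`. -/
def sampledSets (A : AdviceAlgorithm) (m L n : ℕ) : Set (NonemptySubset n) :=
  {s | ∃ a : List Bool, a.length = L ∧
    tvDist (A (List.replicate n false) m a) ((PMF.uniformOfFinset s.1 s.2).map List.ofFn) ≤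
      1 / (m : ℝ)}

open Classical in
/-- The union bound over all advice strings. -/
theorem card_sampledSets_le (A : AdviceAlgorithm) (L k : ℕ) :
    (((sampledSets A 32 L (k + 3)).toFinset.card : ℕ) : ℝ) * 4 ^ 2 ^ k ≤
      2 ^ L * 2 ^ 2 ^ (k + 3) := by
  let G : (Fin L → Bool) → Finset (NonemptySubset (k + 3)) := fun a =>
    Finset.univ.filter fun s =>
      tvDist (A (List.replicate (k + 3) false) 32 (List.ofFn a))
        ((PMF.uniformOfFinset s.1 s.2).map List.ofFn) ≤ 1 / 32
  have hN : Fintype.card (Fin (k + 3) → Bool) = 8 * 2 ^ k := by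
    simp [pow_add]
    ring
  have hsub : (sampledSets A 32 L (k + 3)).toFinset ⊆ Finset.univ.biUnion G := by
    intro s hs
    obtain ⟨a, rfl, h⟩ := Set.mem_toFinset.1 hs
    exact Finset.mem_biUnion.2 ⟨a.get, Finset.mem_univ _,
      Finset.mem_filter.2 ⟨Finset.mem_univ _, by simpa using h⟩⟩
  have hG : ∀ a, ((G a).card : ℝ) * 4 ^ 2 ^ k ≤ 2 ^ 2 ^ (k + 3) := by
    intro a
    have := card_close_le hN List.ofFn_injective
      (A (List.replicate (k + 3) false) 32 (List.ofFn a)) (G a)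
      fun s hs => (Finset.mem_filter.1 hs).2
    simpa using this
  calc (((sampledSets A 32 L (k + 3)).toFinset.card : ℕ) : ℝ) * 4 ^ 2 ^ k
      ≤ (∑ a, (G a).card : ℕ) * 4 ^ 2 ^ k := by
        gcongr
        exact (Finset.card_le_card hsub).trans Finset.card_biUnion_le
    _ = ∑ a, ((G a).card : ℝ) * 4 ^ 2 ^ k := by rw [Nat.cast_sum, Finset.sum_mul]
    _ ≤ ∑ _a : Fin L → Bool, (2 : ℝ) ^ 2 ^ (k + 3) := Finset.sum_le_sum fun a _ => hG a
    _ = 2 ^ L * 2 ^ 2 ^ (k + 3) := by simp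

theorem two_pow_le_card_nonemptySubset (n : ℕ) :
    2 ^ 2 ^ n ≤ 2 * Fintype.card (NonemptySubset n) := by
  have h : Fintype.card (NonemptySubset n) = 2 ^ 2 ^ n - 1 := by
    simp only [NonemptySubset, Finset.nonempty_iff_ne_empty]
    rw [Fintype.card_subtype_compl]
    simp
  have : 2 ≤ 2 ^ 2 ^ n := by
    calc 2 = 2 ^ 1 := by norm_num
      _ ≤ 2 ^ 2 ^ n := Nat.pow_le_pow_right (by norm_num) Nat.one_le_two_pow
  omega

theorem measure_sampledSets_le (A : AdviceAlgorithm) {L k j : ℕ} (h : L + j + 1 ≤ 2 ^ k) :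
    (PMF.uniformOfFintype (NonemptySubset (k + 3))).toMeasure (sampledSets A 32 L (k + 3)) ≤
      (2⁻¹ : ENNReal) ^ j := by
  classical
  rw [PMF.toMeasure_uniformOfFintype_apply _ MeasurableSpace.measurableSet_top, ← Set.toFinset_card]
  have h₁ := card_sampledSets_le A L k
  have h₂ := two_pow_le_card_nonemptySubset (k + 3)
  have h₃ : (2 : ℝ) ^ L * (2 * 2 ^ j) ≤ 4 ^ 2 ^ k := by
    calc (2 : ℝ) ^ L * (2 * 2 ^ j) = 2 ^ (L + j + 1) := by ring
      _ ≤ 2 ^ 2 ^ k := pow_le_pow_right₀ (by norm_num) h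
      _ ≤ 4 ^ 2 ^ k := by gcongr; norm_num
  have h₄ : ((sampledSets A 32 L (k + 3)).toFinset.card : ℝ) * 2 ^ j ≤
      Fintype.card (NonemptySubset (k + 3)) := by
    have h₂' : (2 : ℝ) ^ 2 ^ (k + 3) ≤ 2 * Fintype.card (NonemptySubset (k + 3)) := by
      exact_mod_cast h₂
    have h₅ : (((sampledSets A 32 L (k + 3)).toFinset.card : ℕ) : ℝ) * (2 ^ L * (2 * 2 ^ j)) ≤
        2 ^ L * (2 * Fintype.card (NonemptySubset (k + 3))) :=
      calc _ ≤ _ := by gcongr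
        _ ≤ _ := h₁
        _ ≤ _ := by gcongr
    have h₆ : (0 : ℝ) < 2 ^ L * 2 := by positivity
    refine le_of_mul_le_mul_left ?_ h₆
    calc _ = (((sampledSets A 32 L (k + 3)).toFinset.card : ℕ) : ℝ) * (2 ^ L * (2 * 2 ^ j)) := by
          ring
      _ ≤ _ := h₅
      _ = _ := by ring
  have h₇ : (sampledSets A 32 L (k + 3)).toFinset.card * 2 ^ j ≤
      Fintype.card (NonemptySubset (k + 3)) := by exact_mod_cast h₄
  rw [← ENNReal.inv_pow]
  refine ENNReal.div_le_of_le_mul ?_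
  rw [mul_comm, ← div_eq_mul_inv, ENNReal.le_div_iff_mul_le (by simp) (by simp)]
  exact_mod_cast h₇

instance randomSubsets.instIsProbabilityMeasure : IsProbabilityMeasure randomSubsets := by
  unfold randomSubsets
  infer_instance

theorem ae_uniformProblem_notMem_sampPoly {𝒜 : AdviceAlgorithm → Prop} (h : {A | 𝒜 A}.Countable) :
    ∀ᵐ S ∂randomSubsets, uniformProblem S ∉ SampPoly 𝒜 := by
  have key : ∀ (A : AdviceAlgorithm) (p : MvPolynomial (Fin 2) ℕ),
      ∀ᵐ S ∂randomSubsets, ¬ ∀ n, S n ∈ sampledSets A 32 (evalPoly p n 32) n := by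
    intro A p
    rw [ae_iff]
    simp only [not_not]
    have hlim : Filter.Tendsto (fun j => (2⁻¹ : ENNReal) ^ j) Filter.atTop (nhds 0) :=
      ENNReal.tendsto_pow_atTop_nhds_zero_of_lt_one (by simp)
    refine le_antisymm (ge_of_tendsto' hlim fun j => ?_) zero_le
    obtain ⟨k, hk⟩ := exists_evalPoly_add_le_two_pow p 32 (j + 1)
    refine le_trans ?_ (measure_sampledSets_le A (L := evalPoly p (k + 3) 32) hk)
    have hmp := measurePreserving_eval_infinitePi
      (fun n => (PMF.uniformOfFintype (NonemptySubset n)).toMeasure) (k + 3)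
    rw [← hmp.measure_preimage MeasurableSpace.measurableSet_top.nullMeasurableSet]
    exact measure_mono fun S hS => hS (k + 3)
  have hall : ∀ᵐ S ∂randomSubsets, ∀ A ∈ {A | 𝒜 A}, ∀ p : MvPolynomial (Fin 2) ℕ,
      ¬ ∀ n, S n ∈ sampledSets A 32 (evalPoly p n 32) n :=
    (ae_ball_iff h).2 fun A _ => ae_all_iff.2 fun p => key A p
  filter_upwards [hall] with S hS
  rintro ⟨-, A, p, a, hA, ha, hS'⟩
  -- A single error bound, `1 / 32`, and a single input `0^n` of each length suffice.
  refine hS A hA p fun n => ⟨a n 32, ha n 32 (by norm_num), ?_⟩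
  have := hS' (List.replicate n false) 32 (by norm_num)
  rwa [uniformProblem_eq List.length_replicate, List.length_replicate] at this

/-! ### Runs of a machine -/

/-- `b` is reached from `a` by exactly `n` applications of the partial function `f`. -/
def StateTransition.ReachesIn {σ : Type*} (f : σ → Option σ) (n : ℕ) (a b : σ) : Prop :=
  (flip bind f)^[n] (some a) = some b

namespace StateTransition.ReachesIn

variable {σ : Type*} {f : σ → Option σ} {a b c : σ} {m n : ℕ}

theorem refl (a : σ) : ReachesIn f 0 a a := rfl

theorem head (h : f a = some b) (h' : ReachesIn f n b c) : ReachesIn f (n + 1) a c := by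
  rw [ReachesIn, Function.iterate_succ_apply, show flip bind f (some a) = some b from h]
  exact h'

theorem trans (h : ReachesIn f m a b) (h' : ReachesIn f n b c) : ReachesIn f (m + n) a c := by
  rw [ReachesIn, add_comm, Function.iterate_add_apply, h, h']

end StateTransition.ReachesIn

open Turing StateTransition

/-! ### A machine that outputs its advice -/

namespace AdviceMachine

/-- The alphabets of the input stack `false` and of the output stack `true`. -/
abbrev Alphabet (k : Bool) : Type := cond k Bool (Option Bool)

/-- The contents of the two stacks. -/
def stk (i : List (Option Bool)) (o : List Bool) : ∀ k, List (Alphabet k)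
  | false => i
  | true => o

/-- In phase `l` the machine reads the `l`-th word of its input `x#0^m#y#r#`. It moves the letters
of the word `y`, which has number `2`, to the output stack, where they arrive in reverse order. -/
def program (l : Fin 4) : TM2.Stmt Alphabet (Fin 4) (Option (Option Bool)) :=
  .pop false (fun _ o => o) <|
  .branch (fun s => s.isNone) .halt <|
  .branch (fun s => s == some none) (.goto fun _ => l + 1) <|
  .branch (fun _ => l == 2) (.push true (fun s => s.join.getD false) (.goto fun _ => l)) <|
  .goto fun _ => l

/-- The machine with this program, which starts and halts in the state `none`. -/
def machine : FinTM2 where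
  K := Bool
  k₀ := false
  k₁ := true
  Γ := Alphabet
  Λ := Fin 4
  main := 0
  σ := Option (Option Bool)
  initialState := none
  Γk₀Fin := inferInstanceAs (Fintype (Option Bool))
  m := program

theorem update_false (i i' : List (Option Bool)) (o : List Bool) :
    Function.update (stk i o) false i' = stk i' o := by
  funext k; cases k <;> rfl

theorem update_true (i : List (Option Bool)) (o o' : List Bool) :
    Function.update (stk i o) true o' = stk i o' := by
  funext k; cases k <;> rfl

theorem step_nil (l : Fin 4) (v : Option (Option Bool)) (o : List Bool) :
    TM2.step program ⟨some l, v, stk [] o⟩ = some ⟨none, none, stk [] o⟩ := by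
  simp [program, TM2.step, TM2.stepAux, stk, update_false]

theorem step_none (l : Fin 4) (v : Option (Option Bool)) (i : List (Option Bool))
    (o : List Bool) :
    TM2.step program ⟨some l, v, stk (none :: i) o⟩ =
      some ⟨some (l + 1), some none, stk i o⟩ := by
  simp [program, TM2.step, TM2.stepAux, stk, update_false]

theorem step_some (l : Fin 4) (v : Option (Option Bool)) (b : Bool) (i : List (Option Bool))
    (o : List Bool) :
    TM2.step program ⟨some l, v, stk (some b :: i) o⟩ =
      some ⟨some l, some (some b), stk i (if l = 2 then b :: o else o)⟩ := by
  by_cases h : l = 2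
  · simp [program, TM2.step, TM2.stepAux, stk, update_false, update_true, h]
  · simp [program, TM2.step, TM2.stepAux, stk, update_false, h, beq_eq_false_iff_ne.2 h]

theorem run_word (l : Fin 4) (v : Option (Option Bool)) (w : List Bool) (i : List (Option Bool))
    (o : List Bool) :
    ReachesIn (TM2.step program) (w.length + 1) ⟨some l, v, stk (w.map some ++ none :: i) o⟩
      ⟨some (l + 1), some none, stk i (if l = 2 then w.reverse ++ o else o)⟩ := by
  induction w generalizing v o with
  | nil => simpa using ReachesIn.head (step_none l v i o) (.refl _)
  | cons b w ih =>
    refine ReachesIn.head (step_some l v b _ o) ?_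
    have h := ih (some (some b)) (if l = 2 then b :: o else o)
    by_cases hl : l = 2
    · simpa [hl] using h
    · simpa [hl] using h

theorem run (x : List Bool) (m : ℕ) (y r : List Bool) :
    ReachesIn (TM2.step program) ((encodeRandomizedInput (x, m, y, r)).length + 1)
      ⟨some 0, none, stk (encodeRandomizedInput (x, m, y, r)) []⟩
      ⟨none, none, stk [] y.reverse⟩ := by
  have h₀ := run_word 0 none x ((List.replicate m false).map some ++
    none :: (y.map some ++ none :: (r.map some ++ none :: []))) []
  have h₁ := run_word 1 (some none) (List.replicate m false)
    (y.map some ++ none :: (r.map some ++ none :: [])) []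
  have h₂ := run_word 2 (some none) y (r.map some ++ none :: []) []
  have h₃ := run_word 3 (some none) r [] y.reverse
  have h₄ := ReachesIn.head (step_nil 0 (some none) y.reverse) (.refl _)
  simp only [List.append_nil, if_true] at h₂
  have h := (((h₀.trans h₁).trans h₂).trans h₃).trans h₄
  convert h using 1
  · simp [encodeRandomizedInput, encodeWords]
    ring
  · simp [encodeRandomizedInput, encodeWords]

theorem initList_machine (i : List (Option Bool)) :
    initList machine i = (⟨some (0 : Fin 4), none, stk i []⟩ : TM2.Cfg Alphabet _ _) := by
  simp only [initList, machine]
  congr 1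
  funext k
  cases k <;> rfl

theorem haltList_machine (o : List Bool) :
    haltList machine o = (⟨none, none, stk [] o⟩ : TM2.Cfg Alphabet _ _) := by
  simp only [haltList, machine]
  congr 1
  funext k
  cases k <;> rfl

theorem computableInPolyTime :
    Nonempty (TM2ComputableInPolyTime encodeRandomizedInput id
      fun i : List Bool × ℕ × List Bool × List Bool => i.2.2.1.reverse) := by
  refine ⟨{ tm := machine, inputAlphabet := Equiv.refl _, outputAlphabet := Equiv.refl _,
            time := Polynomial.X + 1,
            outputsFun := fun a => ⟨⟨(encodeRandomizedInput a).length + 1, ?_⟩, by simp⟩ }⟩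
  have hid : ∀ {α : Type} (l : List α), l.map (Equiv.refl α).invFun = l := List.map_id
  obtain ⟨x, m, y, r⟩ := a
  -- `erw` sees through the equality of `machine.Γ machine.k₀` with `Option Bool`.
  erw [hid, hid, initList_machine, Option.map_some, haltList_machine]
  exact run x m y r

end AdviceMachine

/-! ### A machine that writes down a circuit -/

namespace ReversalMachine

/-- The stacks: input, output and two counters. -/
inductive Stack
  | input
  | output
  | counter (d : Bool)
  deriving DecidableEq, Fintype

/-- The alphabets of the stacks; a counter holds its value in unary. -/
abbrev Alphabet : Stack → Type
  | .input => Option Bool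
  | .output => CircuitLetter
  | .counter _ => Unit

/-- The labels: in `read p d` the machine reads the `p`-th word of its input, and in `copy p d` it
copies the value of the counter to the output; `d` is the counter in use. In
`clean d` it empties the counter before it halts. -/
inductive Label
  | read (p : Fin 3) (d : Bool)
  | copy (p : Fin 3) (d : Bool)
  | clean (d : Bool)
  deriving Fintype

/-- For each letter of the words `0^n` and `0^k` of its input `0^n#0^m#0^k#` the machine writes the
letter `O`, increases the counter to the next value `c`, and writes `c` ticks, moving the
counter from one of the two counter stacks to the other. The output stack is read from its top, so
what is written last comes first. -/
def program : Label → TM2.Stmt Alphabet Label (Option (Option Bool))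
  | .read p d =>
    .pop .input (fun _ o => o) <|
    .branch (fun s => s.isNone) (.goto fun _ => .clean d) <|
    .branch (fun s => s == some none) (.goto fun _ => .read (p + 1) d) <|
    .branch (fun _ => p == 1) (.goto fun _ => .read p d) <|
    .push .output (fun _ => .O) <|
    .push (.counter d) (fun _ => ()) <|
    .goto fun _ => .copy p d
  | .copy p d =>
    .pop (.counter d) (fun _ o => o.map fun _ => none) <|
    .branch (fun s => s.isNone) (.goto fun _ => .read p !d) <|
    .push (.counter !d) (fun _ => ()) <|
    .push .output (fun _ => .tick) <|
    .goto fun _ => .copy p d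
  | .clean d =>
    .pop (.counter d) (fun _ o => o.map fun _ => none) <|
    .branch (fun s => s.isNone) .halt <|
    .goto fun _ => .clean d

/-- The machine with this program, which starts and halts in the state `none`. -/
def machine : FinTM2 where
  K := Stack
  k₀ := .input
  k₁ := .output
  Γ := Alphabet
  Λ := Label
  main := .read 0 false
  σ := Option (Option Bool)
  initialState := none
  Γk₀Fin := inferInstanceAs (Fintype (Option Bool))
  m := program

/-- The contents of the stacks when the counters `d` and `!d` have the values `c` and `e`. -/
def stk (i : List (Option Bool)) (o : List CircuitLetter) (d : Bool) (c e : ℕ) :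
    ∀ k, List (Alphabet k)
  | .input => i
  | .output => o
  | .counter d' => List.replicate (if d' = d then c else e) ()

theorem update_input (i i' : List (Option Bool)) (o : List CircuitLetter) (d : Bool) (c e : ℕ) :
    Function.update (stk i o d c e) .input i' = stk i' o d c e := by
  funext k; cases k <;> rfl

theorem update_output (i : List (Option Bool)) (o o' : List CircuitLetter) (d : Bool)
    (c e : ℕ) : Function.update (stk i o d c e) .output o' = stk i o' d c e := by
  funext k; cases k <;> rfl

theorem update_counter (i : List (Option Bool)) (o : List CircuitLetter) (d : Bool)
    (c c' e : ℕ) :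
    Function.update (stk i o d c e) (.counter d) (List.replicate c' ()) = stk i o d c' e := by
  funext k
  rcases k with _ | _ | d'
  · rfl
  · rfl
  · by_cases h : d' = d
    · subst h; simp [stk]
    · simp [stk, h]

theorem stk_not (i : List (Option Bool)) (o : List CircuitLetter) (d : Bool) (c e : ℕ) :
    stk i o (!d) c e = stk i o d e c := by
  funext k
  rcases k with _ | _ | d'
  · rfl
  · rfl
  · cases d <;> cases d' <;> rfl

theorem update_counter_not (i : List (Option Bool)) (o : List CircuitLetter) (d : Bool)
    (c e e' : ℕ) :
    Function.update (stk i o d c e) (.counter !d) (List.replicate e' ()) = stk i o d c e' := by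
  rw [← stk_not, update_counter, stk_not]

theorem step_read_nil (p : Fin 3) (d : Bool) (v : Option (Option Bool)) (o : List CircuitLetter)
    (c : ℕ) :
    TM2.step program ⟨some (.read p d), v, stk [] o d c 0⟩ =
      some ⟨some (.clean d), none, stk [] o d c 0⟩ := by
  simp [program, TM2.step, TM2.stepAux, stk, update_input]

theorem step_read_none (p : Fin 3) (d : Bool) (v : Option (Option Bool))
    (i : List (Option Bool)) (o : List CircuitLetter) (c : ℕ) :
    TM2.step program ⟨some (.read p d), v, stk (none :: i) o d c 0⟩ =
      some ⟨some (.read (p + 1) d), some none, stk i o d c 0⟩ := by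
  simp [program, TM2.step, TM2.stepAux, stk, update_input]

theorem step_read_skip (d : Bool) (v : Option (Option Bool)) (b : Bool)
    (i : List (Option Bool)) (o : List CircuitLetter) (c : ℕ) :
    TM2.step program ⟨some (.read 1 d), v, stk (some b :: i) o d c 0⟩ =
      some ⟨some (.read 1 d), some (some b), stk i o d c 0⟩ := by
  simp [program, TM2.step, TM2.stepAux, stk, update_input]

theorem step_read_some {p : Fin 3} (hp : p ≠ 1) (d : Bool) (v : Option (Option Bool)) (b : Bool)
    (i : List (Option Bool)) (o : List CircuitLetter) (c : ℕ) :
    TM2.step program ⟨some (.read p d), v, stk (some b :: i) o d c 0⟩ =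
      some ⟨some (.copy p d), some (some b), stk i (.O :: o) d (c + 1) 0⟩ := by
  have h := update_counter i (.O :: o) d c (c + 1) 0
  rw [List.replicate_succ] at h
  simp_all [program, TM2.step, TM2.stepAux, stk, update_input, update_output,
    beq_eq_false_iff_ne.2 hp]

theorem step_copy_zero (p : Fin 3) (d : Bool) (v : Option (Option Bool))
    (i : List (Option Bool)) (o : List CircuitLetter) (e : ℕ) :
    TM2.step program ⟨some (.copy p d), v, stk i o d 0 e⟩ =
      some ⟨some (.read p !d), none, stk i o (!d) e 0⟩ := by
  have := update_counter i o d 0 0 e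
  simp_all [program, TM2.step, TM2.stepAux, stk, stk_not]

theorem step_copy_succ (p : Fin 3) (d : Bool) (v : Option (Option Bool))
    (i : List (Option Bool)) (o : List CircuitLetter) (c e : ℕ) :
    TM2.step program ⟨some (.copy p d), v, stk i o d (c + 1) e⟩ =
      some ⟨some (.copy p d), some none, stk i (.tick :: o) d c (e + 1)⟩ := by
  have h₁ := update_counter i o d (c + 1) c e
  have h₂ := update_counter_not i o d c e (e + 1)
  rw [List.replicate_succ] at h₂
  simp_all [program, TM2.step, TM2.stepAux, stk, update_output, List.head?_replicate]

theorem step_clean_zero (d : Bool) (v : Option (Option Bool)) (o : List CircuitLetter) :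
    TM2.step program ⟨some (.clean d), v, stk [] o d 0 0⟩ =
      some ⟨none, none, stk [] o d 0 0⟩ := by
  have := update_counter [] o d 0 0 0
  simp_all [program, TM2.step, TM2.stepAux, stk]

theorem step_clean_succ (d : Bool) (v : Option (Option Bool)) (o : List CircuitLetter) (c : ℕ) :
    TM2.step program ⟨some (.clean d), v, stk [] o d (c + 1) 0⟩ =
      some ⟨some (.clean d), some none, stk [] o d c 0⟩ := by
  have := update_counter [] o d (c + 1) c 0
  simp_all [program, TM2.step, TM2.stepAux, stk, List.head?_replicate]

theorem run_copy (p : Fin 3) (d : Bool) (v : Option (Option Bool)) (i : List (Option Bool))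
    (o : List CircuitLetter) (c e : ℕ) :
    ReachesIn (TM2.step program) (c + 1) ⟨some (.copy p d), v, stk i o d c e⟩
      ⟨some (.read p !d), none, stk i (unary c ++ o) (!d) (c + e) 0⟩ := by
  induction c generalizing v o e with
  | zero => simpa [unary] using ReachesIn.head (step_copy_zero p d v i o e) (.refl _)
  | succ c ih =>
    have h := ReachesIn.head (step_copy_succ p d v i o c e) (ih (some none) (.tick :: o) (e + 1))
    have hu : unary c ++ CircuitLetter.tick :: o = unary (c + 1) ++ o := by
      simp [unary, List.replicate_succ']
    rwa [hu, show c + (e + 1) = c + 1 + e by ring] at h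

theorem run_clean (d : Bool) (v : Option (Option Bool)) (o : List CircuitLetter) (c : ℕ) :
    ReachesIn (TM2.step program) (c + 1) ⟨some (.clean d), v, stk [] o d c 0⟩
      ⟨none, none, stk [] o d 0 0⟩ := by
  induction c generalizing v with
  | zero => exact ReachesIn.head (step_clean_zero d v o) (.refl _)
  | succ c ih => exact ReachesIn.head (step_clean_succ d v o c) (ih _)

/-- What the machine has written when its counter has the value `c`. -/
def written : ℕ → List CircuitLetter
  | 0 => []
  | c + 1 => unary (c + 1) ++ .O :: written c

theorem run_word {p : Fin 3} (hp : p ≠ 1) (d : Bool) (v : Option (Option Bool))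
    (i : List (Option Bool)) (a c : ℕ) :
    ∃ t ≤ a * (c + a + 2) + 1, ∃ d', ReachesIn (TM2.step program) t
      ⟨some (.read p d), v, stk ((List.replicate a false).map some ++ none :: i) (written c) d c 0⟩
      ⟨some (.read (p + 1) d'), some none, stk i (written (c + a)) d' (c + a) 0⟩ := by
  induction a generalizing d v c with
  | zero =>
    exact ⟨1, by omega, d, ReachesIn.head (step_read_none p d v i _ c) (.refl _)⟩
  | succ a ih =>
    obtain ⟨t, ht, d', h⟩ := ih (!d) none (c + 1)
    refine ⟨c + 1 + 1 + t + 1, by nlinarith, d', ?_⟩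
    refine ReachesIn.head (step_read_some hp d v false _ _ c)
      ((run_copy p d _ _ _ (c + 1) 0).trans ?_)
    rwa [show c + 1 + a = c + (a + 1) by ring] at h

theorem run_skip (d : Bool) (v : Option (Option Bool)) (i : List (Option Bool))
    (o : List CircuitLetter) (a c : ℕ) :
    ReachesIn (TM2.step program) (a + 1)
      ⟨some (.read 1 d), v, stk ((List.replicate a false).map some ++ none :: i) o d c 0⟩
      ⟨some (.read 2 d), some none, stk i o d c 0⟩ := by
  induction a generalizing v with
  | zero => exact ReachesIn.head (step_read_none 1 d v i _ c) (.refl _)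
  | succ a ih => exact ReachesIn.head (step_read_skip d v false _ _ c) (ih _)

theorem run (n m k : ℕ) :
    ∃ t ≤ ((encodeLengths (n, m, k)).length + 1) ^ 2, ReachesIn (TM2.step program) t
      ⟨some (.read 0 false), none, stk (encodeLengths (n, m, k)) [] false 0 0⟩
      ⟨none, none, stk [] (written (n + k)) false 0 0⟩ := by
  obtain ⟨t₀, ht₀, d₀, h₀⟩ := run_word (p := 0) (by decide) false none
    ((List.replicate m false).map some ++ none ::
      ((List.replicate k false).map some ++ none :: [])) n 0
  simp only [zero_add] at h₀
  have h₁ := run_skip d₀ (some none) ((List.replicate k false).map some ++ none :: [])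
    (written n) m n
  obtain ⟨t₂, ht₂, d₂, h₂⟩ := run_word (p := 2) (by decide) d₀ (some none) [] k n
  have h₃ := ReachesIn.head (step_read_nil 0 d₂ (some none) (written (n + k)) (n + k))
    (run_clean d₂ _ _ _)
  have h := ((h₀.trans h₁).trans h₂).trans h₃
  refine ⟨t₀ + (m + 1) + t₂ + (n + k + 1 + 1), ?_, ?_⟩
  rotate_left
  · convert h using 2
    · simp [encodeLengths, encodeWords, written]
    · cases d₂
      · rfl
      · exact stk_not _ _ true 0 0
  · simp only [encodeLengths, encodeWords, List.flatMap_cons, List.flatMap_nil, List.length_append,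
      List.length_map, List.length_replicate, List.length_cons, List.length_nil]
    nlinarith [Nat.zero_le (n * m), Nat.zero_le (m * k), Nat.zero_le (n * k), Nat.zero_le (m * m),
      Nat.zero_le n, Nat.zero_le k]

/-- The circuit without gates on `n + k` qubits that outputs all of its qubits in reverse order. -/
def circuit (i : ℕ × ℕ × ℕ) : QCircuit where
  width := i.1 + i.2.2
  gates := []
  output := (List.finRange (i.1 + i.2.2)).reverse

theorem written_eq (c : ℕ) :
    written c = unary c ++
      (List.range c).reverse.flatMap fun i => CircuitLetter.O :: unary i := by
  induction c with
  | zero => rfl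
  | succ c ih => rw [written, ih, List.range_succ]; simp

theorem encode_circuit (n m k : ℕ) : (circuit (n, m, k)).encode = written (n + k) := by
  rw [QCircuit.encode_eq, written_eq]
  simp [circuit, List.map_reverse]

theorem initList_machine (i : List (Option Bool)) :
    initList machine i =
      (⟨some (.read 0 false), none, stk i [] false 0 0⟩ : TM2.Cfg Alphabet Label _) := by
  simp only [initList, machine]
  congr 1
  funext k
  rcases k with _ | _ | _ | _ <;> rfl

theorem haltList_machine (o : List CircuitLetter) :
    haltList machine o = (⟨none, none, stk [] o false 0 0⟩ : TM2.Cfg Alphabet Label _) := by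
  simp only [haltList, machine]
  congr 1
  funext k
  rcases k with _ | _ | _ | _ <;> rfl

theorem computableInPolyTime :
    Nonempty (TM2ComputableInPolyTime encodeLengths QCircuit.encode circuit) := by
  have hrun : ∀ a : ℕ × ℕ × ℕ, ∃ t ≤ ((encodeLengths a).length + 1) ^ 2,
      ReachesIn (TM2.step program)
        t ⟨some (.read 0 false), none, stk (encodeLengths a) [] false 0 0⟩
        ⟨none, none, stk [] (circuit a).encode false 0 0⟩ := by
    rintro ⟨n, m, k⟩
    rw [encode_circuit]
    exact run n m k
  choose t ht h using hrun
  refine ⟨{ tm := machine, inputAlphabet := Equiv.refl _, outputAlphabet := Equiv.refl _,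
            time := (Polynomial.X + 1) ^ 2,
            outputsFun := fun a => ⟨⟨t a, ?_⟩, by simpa using ht a⟩ }⟩
  have hid : ∀ {α : Type} (l : List α), l.map (Equiv.refl α).invFun = l := List.map_id
  -- `erw` sees through the equality of `machine.Γ machine.k₀` with `Option Bool`.
  erw [hid, hid, initList_machine, Option.map_some, haltList_machine]
  exact h a

end ReversalMachine

/-! ### Random advice -/

theorem uniformProblem_polynomiallyBounded (S : (n : ℕ) → NonemptySubset n) :
    (uniformProblem S).PolynomiallyBounded := by
  refine ⟨Polynomial.X, fun x z hz => ?_⟩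
  obtain ⟨b, -, rfl⟩ := (PMF.mem_support_map_iff _ _ _).1 hz
  simp

theorem isPolyTimeRandomized_reverse : IsPolyTimeRandomized fun _ _ y => PMF.pure y.reverse :=
  ⟨fun i => i.2.2.1.reverse, 0, AdviceMachine.computableInPolyTime,
    fun _ _ _ => (PMF.map_const _ _).symm⟩

theorem QCircuit.outputDist_of_gates_eq_nil {C : QCircuit} (h : C.gates = []) (s : List Bool) :
    C.outputDist s =
      PMF.pure (readOutput (C.output.map fun i : Fin C.width => s.getD i false)) := by
  have hs : C.finalState s = QState.basis C.width s := by
    rw [QCircuit.finalState, h, List.foldl_nil]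
  have hm : C.measure s = PMF.pure fun i : Fin C.width => s.getD i false := by
    refine PMF.ext fun b => ?_
    rw [QCircuit.measure, PMF.ofFintype_apply, PMF.pure_apply, hs, QState.basis]
    split_ifs with hb
    · simp [hb]
    · rw [Pi.single_eq_of_ne hb]
      simp
  rw [QCircuit.outputDist, hm, PMF.pure_map]

theorem outputDist_circuit (s : List Bool) (n m k : ℕ) (h : s.length = n + k) :
    (ReversalMachine.circuit (n, m, k)).outputDist s = PMF.pure (readOutput s.reverse) := by
  rw [QCircuit.outputDist_of_gates_eq_nil rfl]
  congr 2
  simp only [ReversalMachine.circuit, List.map_reverse]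
  congr 1
  rw [← h]
  refine List.ext_getElem (by simp) fun i h₁ h₂ => ?_
  simp

theorem isPolyTimeQuantum_readOutput_reverse :
    IsPolyTimeQuantum fun x _ y => PMF.pure (readOutput (x ++ y).reverse) :=
  ⟨ReversalMachine.circuit, ReversalMachine.computableInPolyTime, fun x m y =>
    (outputDist_circuit (x ++ y) x.length m y.length (by simp)).symm⟩

/-- If some algorithm of the class applies to its advice `y` a map that takes suitable codes
`code b` of strings `b` back to `b`, then a uniformly random element of `S n` can be handed over
as the random advice. -/
theorem uniformProblem_mem_sampRPoly {𝒜 : AdviceAlgorithm → Prop} (S : (n : ℕ) → NonemptySubset n)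
    (g : List Bool → List Bool → List Bool) (hg : 𝒜 fun x _ y => PMF.pure (g x y))
    (code : List Bool → List Bool) (hcode : ∀ x b, g x (code b) = b)
    (p : MvPolynomial (Fin 2) ℕ) (hp : ∀ b m, (code b).length = evalPoly p b.length m) :
    uniformProblem S ∈ SampRPoly 𝒜 := by
  refine ⟨uniformProblem_polynomiallyBounded S, _, p,
    fun n _ => (PMF.uniformOfFinset (S n).1 (S n).2).map fun b => code (List.ofFn b), hg,
    fun n m _ y hy => ?_, fun x m _ => ?_⟩
  · obtain ⟨b, -, rfl⟩ := (PMF.mem_support_map_iff _ _ _).1 hy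
    rw [hp _ m, List.length_ofFn]
  · have h : ((PMF.uniformOfFinset (S x.length).1 (S x.length).2).map fun b =>
        code (List.ofFn b)).bind (fun y => PMF.pure (g x y)) = uniformProblem S x := by
      rw [PMF.bind_map]
      simp only [Function.comp_def, hcode]
      rfl
    dsimp only
    rw [h, tvDist_self]
    positivity

theorem uniformProblem_mem_sampBPPrpoly (S : (n : ℕ) → NonemptySubset n) :
    uniformProblem S ∈ SampBPPrpoly :=
  uniformProblem_mem_sampRPoly S (fun _ y => y.reverse) isPolyTimeRandomized_reverse
    List.reverse (fun _ b => b.reverse_reverse) (MvPolynomial.X 0) fun b m => by simp [evalPoly]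

/-- The self-delimiting code that `readOutput` decodes. -/
def delimitedCode (b : List Bool) : List Bool := b.flatMap (fun c => [false, c]) ++ [true]

theorem readOutput_delimitedCode (b l : List Bool) : readOutput (delimitedCode b ++ l) = b := by
  induction b with
  | nil => simp [delimitedCode, readOutput]
  | cons c b ih =>
    simp only [delimitedCode, List.append_assoc, List.flatMap_cons, List.cons_append,
      List.nil_append, readOutput] at ih ⊢
    rw [ih]

theorem uniformProblem_mem_sampBQPrpoly (S : (n : ℕ) → NonemptySubset n) :
    uniformProblem S ∈ SampBQPrpoly :=
  uniformProblem_mem_sampRPoly S (fun x y => readOutput (x ++ y).reverse)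
    isPolyTimeQuantum_readOutput_reverse (fun b => (delimitedCode b).reverse)
    (fun x b => by rw [List.reverse_append, List.reverse_reverse, readOutput_delimitedCode])
    (2 * MvPolynomial.X 0 + 1) fun b m => by simp [evalPoly, delimitedCode, mul_comm]

/-! ### The separation -/

theorem mainTheorem7 :
    SampBPPpoly ≠ SampBPPrpoly ∧
    SampBQPpoly ≠ SampBQPrpoly ∧
    (∀ S : (n : ℕ) → NonemptySubset n,
      uniformProblem S ∈ SampBPPrpoly ∧ uniformProblem S ∈ SampBQPrpoly) ∧
    (∀ᵐ S ∂randomSubsets,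
      uniformProblem S ∉ SampBPPpoly ∧ uniformProblem S ∉ SampBQPpoly) := by
  have hae : ∀ᵐ S ∂randomSubsets,
      uniformProblem S ∉ SampBPPpoly ∧ uniformProblem S ∉ SampBQPpoly :=
    (ae_uniformProblem_notMem_sampPoly countable_isPolyTimeRandomized).and
      (ae_uniformProblem_notMem_sampPoly countable_isPolyTimeQuantum)
  obtain ⟨S, hS₁, hS₂⟩ := hae.exists
  exact ⟨fun h => hS₁ (h ▸ uniformProblem_mem_sampBPPrpoly S),
    fun h => hS₂ (h ▸ uniformProblem_mem_sampBQPrpoly S),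
    fun S => ⟨uniformProblem_mem_sampBPPrpoly S, uniformProblem_mem_sampBQPrpoly S⟩, hae⟩
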